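/- Definitions. For a non-zero polynomial $f(x)\in\mathbb Z[x]$ put $\tilde f(x)=x^{\deg f}f(1/x)$, and call $f$ reciprocal if $f=\pm\tilde f$ (so non-zero constants are reciprocal). The non-reciprocal part of a non-zero $f(x)\in\mathbb Z[x]$ is the polynomial obtained from $f(x)$ by removing, to the multiplicity to which they occur, all irreducible reciprocal factors of $f$ in $\mathbb Z[x]$ with positive leading coefficient, so that only irreducible non-reciprocal factors (and possibly the sign $\pm1$) remain. A polynomial is reducible if it is a product of two non-units; the units of $\mathbb Z[x]$ and of $\mathbb Z[x,y]$ are $\pm1$. Thus a polynomial in $\mathbb Z[x]$ is not reducible exactly if it is $\pm 1$ or irreducible in $\mathbb Z[x]$. Theorem. Let $r\ge 1$ be an integer and let $$F(x,y)=f_0(x)+f_1(x)y+\cdots+f_r(x)y^r\in\mathbb Z[x,y]$$ with $f_0,\dots,f_r\in\mathbb Z[x]$ such that no element of $\mathbb Z[x]$ other than $\pm1$ divides all of $f_0(x),\dots,f_r(x)$, and such that $f_0(0)\ne 0$ and $f_r(x)\ne 0$. Then there is an $n_0$, depending only on $F$, such that the following holds for every integer $n\ge n_0$. If, for every integer $t\ge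 0$ and every integer $\ell\ge 1$, each of the two polynomials $$\sum_{j=0}^{r} f_j(x)\,x^{jt}\,y^{j\ell}\qquad\text{and}\qquad \sum_{j=0}^{r} f_j(x)\,x^{(r-j)t}\,y^{j\ell}$$ is a power of $x$ (possibly $x^0$) times an irreducible polynomial in $\mathbb Z[x,y]$, then the non-reciprocal part of $F(x,x^n)$ is not reducible in $\mathbb Z[x]$. -/

import Mathlib

open Polynomial
open scoped Polynomial.Bivariate

namespace SparsePoly

/-- A non-zero polynomial `f` over `ℤ` is reciprocal if `f = ± x ^ (deg f) * f (1 / x)`.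
(`Polynomial.reverse f` is the polynomial `x ^ (deg f) * f (1 / x)`.)  In particular every
non-zero constant is reciprocal, and `x` is not. -/
def IsReciprocal (f : ℤ[X]) : Prop :=
  f ≠ 0 ∧ (f = f.reverse ∨ f = -f.reverse)

/-- An element of a ring is reducible if it is a product of two non-units. -/
def Reducible {R : Type*} [CommRing R] (p : R) : Prop :=
  ∃ a b : R, ¬ IsUnit a ∧ ¬ IsUnit b ∧ p = a * b

open Classical in
/-- The non-reciprocal part of `f`: all irreducible reciprocal factors with positive leading
coefficient are removed from `f`, with multiplicity.  Here `normalizedFactors f` is the multiset of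
the irreducible factors of `f` in `ℤ[x]` (constant ones included), each taken with positive leading
coefficient, so that `f` is the sign of its leading coefficient times their product. -/
noncomputable def nonreciprocalPart (f : ℤ[X]) : ℤ[X] :=
  C (Int.sign f.leadingCoeff) *
    ((UniqueFactorizationMonoid.normalizedFactors f).filter (fun p => ¬ IsReciprocal p)).prod

/-- The factors that are collected by `normalizedFactors` have positive leading coefficient. -/
theorem leadingCoeff_pos_of_mem_normalizedFactors {f p : ℤ[X]}
    (hp : p ∈ UniqueFactorizationMonoid.normalizedFactors f) : 0 < p.leadingCoeff := by
  have h := UniqueFactorizationMonoid.normalize_normalized_factor p hp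
  have h0 : p ≠ 0 := (UniqueFactorizationMonoid.irreducible_of_normalized_factor p hp).ne_zero
  have h1 : normalize p.leadingCoeff = p.leadingCoeff := by
    rw [← Polynomial.leadingCoeff_normalize, h]
  have h2 : 0 ≤ p.leadingCoeff := Int.nonneg_of_normalize_eq_self h1
  exact lt_of_le_of_ne h2 (Ne.symm (leadingCoeff_ne_zero.mpr h0))

open Classical in
/-- `f` is its non-reciprocal part times the irreducible reciprocal factors that were removed. -/
theorem nonreciprocalPart_mul_prod {f : ℤ[X]} (hf : f ≠ 0) :
    nonreciprocalPart f *
      ((UniqueFactorizationMonoid.normalizedFactors f).filter IsReciprocal).prod = f := by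
  have h := UniqueFactorizationMonoid.prod_normalizedFactors_eq hf
  rw [← Multiset.filter_add_not IsReciprocal (UniqueFactorizationMonoid.normalizedFactors f),
    Multiset.prod_add] at h
  rw [nonreciprocalPart, mul_assoc, mul_comm (Multiset.prod _), h]
  rcases lt_or_gt_of_ne (leadingCoeff_ne_zero.mpr hf) with h1 | h1
  · rw [Int.sign_eq_neg_one_of_neg h1]
    simp [normalize_apply, Int.normUnit_eq, h1.not_ge]
  · rw [Int.sign_eq_one_of_pos h1]
    simp [normalize_apply, Int.normUnit_eq, h1.le]

/-- `P(x, y)` is a power of `x` (possibly `x ^ 0`) times an irreducible element of `ℤ[x, y]`.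
The ring `ℤ[x, y]` is `ℤ[X][Y]`, the polynomials in `y` with coefficients in `ℤ[x]`. -/
def IsXPowMulIrreducible (P : ℤ[X][Y]) : Prop :=
  ∃ (m : ℕ) (Q : ℤ[X][Y]), Irreducible Q ∧ P = C (X ^ m) * Q

/-- `F(x, y) = f₀(x) + f₁(x) y + ⋯ + f_r(x) y ^ r`. -/
noncomputable def bivariate (r : ℕ) (f : ℕ → ℤ[X]) : ℤ[X][Y] :=
  ∑ j ∈ Finset.range (r + 1), C (f j) * Y ^ j

/-- The polynomial `∑ f_j(x) x ^ (j t) y ^ (j ℓ)`. -/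
noncomputable def twistUp (r : ℕ) (f : ℕ → ℤ[X]) (t l : ℕ) : ℤ[X][Y] :=
  ∑ j ∈ Finset.range (r + 1), C (f j * X ^ (j * t)) * Y ^ (j * l)

/-- The polynomial `∑ f_j(x) x ^ ((r - j) t) y ^ (j ℓ)`. -/
noncomputable def twistDown (r : ℕ) (f : ℕ → ℤ[X]) (t l : ℕ) : ℤ[X][Y] :=
  ∑ j ∈ Finset.range (r + 1), C (f j * X ^ ((r - j) * t)) * Y ^ (j * l)

end SparsePoly

/-!
Let `g = F(x, x ^ n)`, and suppose that its non-reciprocal part is reducible. Then `g = a * b` with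
`a` and `b` both non-reciprocal (`exists_mul_not_isReciprocal`), and `w = a * b.reverse` satisfies
`w * w.reverse = g * g.reverse`. It is enough to show that `g` divides `w` or `w.reverse`: the first
gives `b ∣ b.reverse`, the second `a ∣ a.reverse`, and a polynomial with non-zero constant term that
divides its reversal is reciprocal.

Comparing middle coefficients, `w` and `g` have the same sum of squares of coefficients, so the
number of terms of `w` is bounded in terms of `F` (`card_support_le_of_mul_reverse_eq`,
`sum_sq_coeff_le`). By Dirichlet's simultaneous approximation there is therefore a bounded `q` such
that, with `m = n / q` rounded down, every exponent of `w` is within `m / 8` of a multiple of `m`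
(`exists_add_mod_le`). Write `n = q * m + t`; here `0 ≤ t < q`, so `g` is the value at `y = x ^ m`
of the polynomial `G = ∑ f_j(x) x ^ (j t) y ^ (j q)`, whose degree in `x` is bounded. Likewise
`x ^ c * w`, where `c = m / 8` makes the remainders non-negative, is the value at `y = x ^ m` of
some `W ∈ ℤ[x, y]` of degree at most `2 * c` in `x`. Reversing in both variables carries
`w * w.reverse = g * g.reverse` to an identity `W * W' = G * G'` between polynomials of degree less
than `m` in `x`, on which the substitution `y = x ^ m` is injective
(`eq_zero_of_eval_X_pow_eq_zero`). As `G` is prime, it divides `W` or `W'`, and substituting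
`y = x ^ m` again shows that `g` divides `w` or `w.reverse` (`dvd_or_dvd_reverse_of_prime`).
-/

namespace SparsePoly

/-! ### Reciprocal polynomials and the splitting of a reducible non-reciprocal part -/

theorem reverse_reverse_of_coeff_zero_ne {p : ℤ[X]} (hp : p.coeff 0 ≠ 0) :
    p.reverse.reverse = p := by
  have h : p.natTrailingDegree = 0 :=
    natTrailingDegree_eq_zero.mpr (Or.inr hp)
  have h1 := mirror_mirror p
  have h2 : p.mirror = p.reverse := by simp [mirror, h]
  have h3 : p.reverse.natTrailingDegree = 0 := by simp [em]
  rw [h2] at h1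
  simpa [mirror, h3] using h1

theorem coeff_zero_ne_of_dvd {p q : ℤ[X]} (h : p ∣ q) (hq : q.coeff 0 ≠ 0) : p.coeff 0 ≠ 0 := by
  obtain ⟨k, rfl⟩ := h
  rw [mul_coeff_zero] at hq
  exact left_ne_zero_of_mul hq

theorem reverse_dvd_reverse {p q : ℤ[X]} (h : p ∣ q) : p.reverse ∣ q.reverse := by
  obtain ⟨k, rfl⟩ := h
  rw [reverse_mul_of_domain]
  exact dvd_mul_right _ _

theorem isReciprocal_of_dvd_reverse {p : ℤ[X]} (hp : p.coeff 0 ≠ 0) (h : p ∣ p.reverse) :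
    IsReciprocal p := by
  have h0 : p ≠ 0 := by rintro rfl; simp at hp
  obtain ⟨k, hk⟩ := h
  have h1 : p.reverse.reverse = p.reverse * k.reverse := by
    conv_lhs => rw [hk]
    rw [reverse_mul_of_domain]
  rw [reverse_reverse_of_coeff_zero_ne hp, hk] at h1
  have h2 : k * k.reverse = 1 := by
    apply mul_left_cancel₀ h0
    rw [← mul_assoc, ← h1, mul_one]
  have h3 : IsUnit k := IsUnit.of_mul_eq_one _ h2
  obtain ⟨c, hc, rfl⟩ := Polynomial.isUnit_iff.mp h3
  refine ⟨h0, ?_⟩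
  rcases Int.isUnit_iff.mp hc with rfl | rfl
  · left; rw [hk]; simp
  · right; rw [hk]; simp

theorem IsReciprocal.dvd_reverse {p : ℤ[X]} (hp : IsReciprocal p) : p ∣ p.reverse := by
  rcases hp.2 with h | h
  · exact h ▸ dvd_rfl
  · exact ⟨-1, by rw [mul_neg_one]; exact neg_eq_iff_eq_neg.mp (by rw [← h])⟩

theorem IsReciprocal.reverse_dvd {p : ℤ[X]} (hp : IsReciprocal p) : p.reverse ∣ p := by
  rcases hp.2 with h | h
  · exact ⟨1, by rw [mul_one]; exact h⟩
  · exact ⟨-1, by rw [mul_neg_one]; exact h⟩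

theorem IsReciprocal.mul {p q : ℤ[X]} (hp : IsReciprocal p) (hq : IsReciprocal q) :
    IsReciprocal (p * q) := by
  refine ⟨mul_ne_zero hp.1 hq.1, ?_⟩
  rw [reverse_mul_of_domain]
  rcases hp.2 with h | h <;> rcases hq.2 with h' | h'
  · left; rw [← h, ← h']
  · right; rw [← mul_neg, ← h', ← h]
  · right; rw [← neg_mul, ← h, ← h']
  · left; rw [← neg_mul_neg p.reverse, ← h, ← h']

theorem IsReciprocal.of_mul_right {p q : ℤ[X]} (hq : IsReciprocal q) (hpq : IsReciprocal (p * q))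
    (h0 : p.coeff 0 ≠ 0) : IsReciprocal p := by
  apply isReciprocal_of_dvd_reverse h0
  have h := hpq.dvd_reverse
  rw [reverse_mul_of_domain] at h
  exact (mul_dvd_mul_iff_right hq.1).mp (h.trans (mul_dvd_mul_left _ hq.reverse_dvd))

theorem isReciprocal_multiset_prod {s : Multiset ℤ[X]} (h : ∀ p ∈ s, IsReciprocal p) :
    IsReciprocal s.prod := by
  induction s using Multiset.induction_on with
  | empty => exact ⟨by simp, Or.inl (by simpa using (reverse_C (1 : ℤ)).symm)⟩
  | cons a s ih =>
    rw [Multiset.prod_cons]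
    exact (h a (by simp)).mul (ih fun p hp => h p (by simp [hp]))

theorem not_isReciprocal_of_irreducible_of_dvd_nonreciprocalPart {g u : ℤ[X]}
    (hg : g.coeff 0 ≠ 0) (hu : Irreducible u) (h : u ∣ nonreciprocalPart g) :
    ¬ IsReciprocal u := by
  classical
  have hg0 : g ≠ 0 := by rintro rfl; simp at hg
  have hs : IsUnit (C (Int.sign g.leadingCoeff)) := by
    rw [isUnit_C, Int.isUnit_iff]
    rcases lt_or_gt_of_ne (leadingCoeff_ne_zero.mpr hg0) with h1 | h1
    · exact Or.inr (Int.sign_eq_neg_one_of_neg h1)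
    · exact Or.inl (Int.sign_eq_one_of_pos h1)
  rw [nonreciprocalPart, hs.dvd_mul_left] at h
  obtain ⟨p, hp, hup⟩ := hu.prime.exists_mem_multiset_dvd h
  rw [Multiset.mem_filter] at hp
  have hpi := UniqueFactorizationMonoid.irreducible_of_normalized_factor p hp.1
  have hpu : p ∣ u := (hu.associated_of_dvd hpi hup).symm.dvd
  have hp0 := coeff_zero_ne_of_dvd (UniqueFactorizationMonoid.dvd_of_mem_normalizedFactors hp.1) hg
  intro hr
  -- `p` and `u` are associated, so `p ∣ u ∣ u.reverse ∣ p.reverse` would make `p` reciprocal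
  exact hp.2 (isReciprocal_of_dvd_reverse hp0
    (hpu.trans (hr.dvd_reverse.trans (reverse_dvd_reverse hup))))

/-- If a reciprocal divisor of `g` has a non-reciprocal irreducible factor `u`, then `u.reverse`
divides `g` too, and splitting off the full power of `u` leaves a cofactor divisible by `u.reverse`
but not by `u`. -/
theorem exists_mul_not_isReciprocal_of_dvd {g a u : ℤ[X]} (hg : g.coeff 0 ≠ 0) (hag : a ∣ g)
    (ha : IsReciprocal a) (hu : Irreducible u) (hua : u ∣ a) (hur : ¬ IsReciprocal u) :
    ∃ p q : ℤ[X], g = p * q ∧ ¬ IsReciprocal p ∧ ¬ IsReciprocal q := by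
  have hg0 : g ≠ 0 := by rintro rfl; simp at hg
  have hu0 := coeff_zero_ne_of_dvd (hua.trans hag) hg
  have hnd : ¬ u ∣ u.reverse := fun h => hur (isReciprocal_of_dvd_reverse hu0 h)
  have hfin : FiniteMultiplicity u g :=
    FiniteMultiplicity.of_not_isUnit hu.not_isUnit hg0
  obtain ⟨q, hq, hqu⟩ := hfin.exists_eq_pow_mul_and_not_dvd
  have hk : 1 ≤ multiplicity u g :=
    hfin.le_multiplicity_of_pow_dvd (by simpa using hua.trans hag)
  have hpow : (u ^ multiplicity u g).reverse = u.reverse ^ multiplicity u g := by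
    induction multiplicity u g with
    | zero => simpa using reverse_C (1 : ℤ)
    | succ k ih => rw [pow_succ, pow_succ, reverse_mul_of_domain, ih]
  refine ⟨_, q, hq, fun h => ?_, fun h => hqu ?_⟩
  · refine hnd (hu.prime.dvd_of_dvd_pow (n := multiplicity u g) ?_)
    rw [← hpow]
    exact (dvd_pow_self u (by lia)).trans h.dvd_reverse
  · have h1 : u ∣ g.reverse :=
      hua.trans (ha.dvd_reverse.trans (reverse_dvd_reverse hag))
    rw [hq, reverse_mul_of_domain, hpow] at h1
    rcases hu.prime.dvd_or_dvd h1 with h2 | h2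
    · exact absurd (hu.prime.dvd_of_dvd_pow h2) hnd
    · exact h2.trans h.reverse_dvd

open Classical in
theorem exists_isReciprocal_nonreciprocalPart_mul_eq {g : ℤ[X]} (hg : g ≠ 0) :
    ∃ R : ℤ[X], IsReciprocal R ∧ nonreciprocalPart g * R = g :=
  ⟨_, isReciprocal_multiset_prod fun _ hp => (Multiset.mem_filter.mp hp).2,
    nonreciprocalPart_mul_prod hg⟩

/-- If the non-reciprocal part of `g` is reducible, then `g` itself is a product of two
non-reciprocal polynomials. -/
theorem exists_mul_not_isReciprocal {g : ℤ[X]} (hg : g.coeff 0 ≠ 0)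
    (h : Reducible (nonreciprocalPart g)) :
    ∃ p q : ℤ[X], g = p * q ∧ ¬ IsReciprocal p ∧ ¬ IsReciprocal q := by
  have hg0 : g ≠ 0 := by rintro rfl; simp at hg
  obtain ⟨a, b, ha, hb, hab⟩ := h
  obtain ⟨R, hR, hRg⟩ := exists_isReciprocal_nonreciprocalPart_mul_eq hg0
  have hdvd : nonreciprocalPart g ∣ g := ⟨R, hRg.symm⟩
  have key : ∀ c : ℤ[X], ¬ IsUnit c → c ∣ nonreciprocalPart g → IsReciprocal c →
      ∃ p q : ℤ[X], g = p * q ∧ ¬ IsReciprocal p ∧ ¬ IsReciprocal q := by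
    intro c hc hcd hcr
    obtain ⟨u, hu, huc⟩ := WfDvdMonoid.exists_irreducible_factor hc hcr.1
    exact exists_mul_not_isReciprocal_of_dvd hg (hcd.trans hdvd) hcr hu huc
      (not_isReciprocal_of_irreducible_of_dvd_nonreciprocalPart hg hu (huc.trans hcd))
  by_cases har : IsReciprocal a
  · exact key a ha ⟨b, hab⟩ har
  by_cases hbr : IsReciprocal b
  · exact key b hb ⟨a, hab.trans (mul_comm a b)⟩ hbr
  refine ⟨a, b * R, by rw [← mul_assoc, ← hab, hRg], har, fun h => hbr (hR.of_mul_right h ?_)⟩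
  exact coeff_zero_ne_of_dvd (Dvd.dvd.trans ⟨a, hab.trans (mul_comm a b)⟩ hdvd) hg

/-! ### The number of terms -/

theorem mirror_eq_reverse_of_coeff_zero_ne {p : ℤ[X]} (hp : p.coeff 0 ≠ 0) :
    p.mirror = p.reverse := by
  simp [mirror, natTrailingDegree_eq_zero.mpr (Or.inr hp)]

/-- The middle coefficient of `p * p.reverse` is the sum of the squares of the coefficients of
`p`, and a non-zero integer has square at least `1`. -/
theorem card_support_le_of_mul_reverse_eq {p g : ℤ[X]} (hp : p.coeff 0 ≠ 0) (hg : g.coeff 0 ≠ 0)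
    (hd : p.natDegree = g.natDegree) (h : p * p.reverse = g * g.reverse) :
    (p.support.card : ℤ) ≤ ∑ i ∈ g.support, g.coeff i ^ 2 := by
  have hp1 := coeff_mul_mirror (p := p)
  have hg1 := coeff_mul_mirror (p := g)
  rw [mirror_eq_reverse_of_coeff_zero_ne hp, natTrailingDegree_eq_zero.mpr (Or.inr hp), h,
    hd] at hp1
  rw [mirror_eq_reverse_of_coeff_zero_ne hg, natTrailingDegree_eq_zero.mpr (Or.inr hg)] at hg1
  have hsum : ∑ i ∈ p.support, p.coeff i ^ 2 = ∑ i ∈ g.support, g.coeff i ^ 2 := hp1.symm.trans hg1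
  calc (p.support.card : ℤ) = ∑ _i ∈ p.support, 1 := by simp
    _ ≤ ∑ i ∈ p.support, p.coeff i ^ 2 := Finset.sum_le_sum fun i hi =>
        Int.add_one_le_of_lt (sq_pos_of_ne_zero (mem_support_iff.mp hi))
    _ = _ := hsum

theorem sum_abs_coeff_add_le (p q : ℤ[X]) (N : ℕ) :
    ∑ i ∈ Finset.range N, |(p + q).coeff i| ≤
      ∑ i ∈ Finset.range N, |p.coeff i| + ∑ i ∈ Finset.range N, |q.coeff i| := by
  rw [← Finset.sum_add_distrib]
  exact Finset.sum_le_sum fun i _ => by rw [coeff_add]; exact abs_add_le _ _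

theorem sum_abs_coeff_mul_X_pow_le (p : ℤ[X]) (k N : ℕ) :
    ∑ i ∈ Finset.range N, |(p * X ^ k).coeff i| ≤ ∑ i ∈ p.support, |p.coeff i| := by
  have h0 : ∑ i ∈ Finset.range k, |(p * X ^ k).coeff i| = 0 :=
    Finset.sum_eq_zero fun i hi => by
      rw [coeff_mul_X_pow', if_neg (by simpa using hi), abs_zero]
  have h1 : ∑ i ∈ Finset.range N, |(p * X ^ k).coeff (k + i)| =
      ∑ i ∈ Finset.range N, |p.coeff i| :=
    Finset.sum_congr rfl fun i _ => by rw [add_comm k, coeff_mul_X_pow]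
  have h2 : ∑ i ∈ Finset.range N, |(p * X ^ k).coeff i| ≤
      ∑ i ∈ Finset.range (k + N), |(p * X ^ k).coeff i| :=
    Finset.sum_le_sum_of_subset_of_nonneg
      (Finset.range_subset_range.mpr (Nat.le_add_left N k)) fun _ _ _ => abs_nonneg _
  rw [Finset.sum_range_add, h0, h1, zero_add] at h2
  refine h2.trans ?_
  rw [← Finset.sum_filter_of_ne (p := fun i => p.coeff i ≠ 0) fun i _ h => abs_ne_zero.mp h]
  refine Finset.sum_le_sum_of_subset_of_nonneg (fun i hi => ?_) fun _ _ _ => abs_nonneg _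
  exact mem_support_iff.mpr (Finset.mem_filter.mp hi).2

/-- With `e j = n * j` this bounds the sum of the squares of the coefficients of `F(x, x ^ n)`
independently of `n`. -/
theorem sum_sq_coeff_le (r : ℕ) (f : ℕ → ℤ[X]) (e : ℕ → ℕ) :
    ∑ i ∈ (∑ j ∈ Finset.range (r + 1), f j * X ^ e j).support,
      (∑ j ∈ Finset.range (r + 1), f j * X ^ e j).coeff i ^ 2 ≤
    (∑ j ∈ Finset.range (r + 1), ∑ i ∈ (f j).support, |(f j).coeff i|) ^ 2 := by
  have key : ∀ (s N : ℕ), ∑ i ∈ Finset.range N,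
      |(∑ j ∈ Finset.range s, f j * X ^ e j).coeff i| ≤
      ∑ j ∈ Finset.range s, ∑ i ∈ (f j).support, |(f j).coeff i| := by
    intro s N
    induction s with
    | zero => simp
    | succ s ih =>
      rw [Finset.sum_range_succ, Finset.sum_range_succ _ s]
      exact (sum_abs_coeff_add_le _ _ _).trans
        (add_le_add ih (sum_abs_coeff_mul_X_pow_le _ _ _))
  set g := ∑ j ∈ Finset.range (r + 1), f j * X ^ e j with hg
  calc ∑ i ∈ g.support, g.coeff i ^ 2 = ∑ i ∈ g.support, |g.coeff i| ^ 2 := by simp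
    _ ≤ (∑ i ∈ g.support, |g.coeff i|) ^ 2 :=
        Finset.sum_sq_le_sq_sum_of_nonneg fun _ _ => abs_nonneg _
    _ ≤ (∑ i ∈ Finset.range (g.natDegree + 1), |g.coeff i|) ^ 2 := by
        refine pow_le_pow_left₀ (Finset.sum_nonneg fun _ _ => abs_nonneg _) ?_ 2
        refine Finset.sum_le_sum_of_subset_of_nonneg (fun i hi => ?_) fun _ _ _ => abs_nonneg _
        have := le_natDegree_of_mem_supp i hi
        rw [Finset.mem_range]; lia
    _ ≤ _ := pow_le_pow_left₀ (Finset.sum_nonneg fun _ _ => abs_nonneg _) (key _ _) 2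

/-! ### Simultaneous approximation of the exponents -/

/-- Dirichlet's simultaneous approximation, for the numbers `e / n` with `e ∈ s`. -/
theorem exists_mul_eq_mul_add_of_card_le (s : Finset ℕ) {K n Q : ℕ} (hs : s.card ≤ K) (hn : 0 < n)
    (hQ : 0 < Q) :
    ∃ q : ℕ, 1 ≤ q ∧ q ≤ Q ^ K ∧ ∀ e ∈ s, ∃ p d : ℤ, (q * e : ℤ) = p * n + d ∧ Q * |d| < n := by
  let c : Fin (Q ^ K + 1) → (s → Fin Q) := fun k e =>
    ⟨Q * ((k.1 * e.1) % n) / n, by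
      rw [Nat.div_lt_iff_lt_mul hn]
      exact Nat.mul_lt_mul_of_pos_left (Nat.mod_lt _ hn) hQ⟩
  have hcard : Fintype.card (s → Fin Q) < Fintype.card (Fin (Q ^ K + 1)) := by
    simp only [Fintype.card_fun, Fintype.card_fin, Fintype.card_coe]
    exact Nat.lt_succ_of_le (Nat.pow_le_pow_right hQ hs)
  obtain ⟨a, b, hab, hc⟩ := Fintype.exists_ne_map_eq_of_card_lt c hcard
  wlog hlt : a.1 < b.1 generalizing a b
  · exact this b a hab.symm hc.symm (lt_of_le_of_ne (not_lt.mp hlt) fun h => hab (Fin.ext h.symm))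
  refine ⟨b - a, by lia, by lia, fun e he => ?_⟩
  have h1 : Q * ((a.1 * e) % n) / n = Q * ((b.1 * e) % n) / n :=
    congrArg Fin.val (congrFun hc ⟨e, he⟩)
  refine ⟨((b.1 * e / n : ℕ) : ℤ) - ((a.1 * e / n : ℕ) : ℤ),
    ((b.1 * e % n : ℕ) : ℤ) - ((a.1 * e % n : ℕ) : ℤ), ?_, ?_⟩
  · have ha := Nat.div_add_mod (a.1 * e) n
    have hb := Nat.div_add_mod (b.1 * e) n
    rw [Nat.cast_sub hlt.le]
    zify at ha hb ⊢
    linear_combination ha - hb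
  · have h2 := Nat.div_add_mod (Q * ((a.1 * e) % n)) n
    have h3 := Nat.div_add_mod (Q * ((b.1 * e) % n)) n
    have h4 := Nat.mod_lt (Q * ((a.1 * e) % n)) hn
    have h5 := Nat.mod_lt (Q * ((b.1 * e) % n)) hn
    rw [h1] at h2
    generalize Q * ((b.1 * e) % n) / n = w at *
    have h6 : (Q : ℤ) * |((b.1 * e % n : ℕ) : ℤ) - ((a.1 * e % n : ℕ) : ℤ)| =
        |((Q * (b.1 * e % n) : ℕ) : ℤ) - ((Q * (a.1 * e % n) : ℕ) : ℤ)| := by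
      rw [Nat.cast_mul, Nat.cast_mul, ← mul_sub, abs_mul, Nat.abs_cast]
    rw [h6, abs_lt]
    generalize Q * (b.1 * e % n) = u at *
    generalize Q * (a.1 * e % n) = v at *
    constructor <;> lia

/-- If `n` is large, the elements of a set of at most `K` natural numbers up to `R * n` all lie
within `m / 8` of the multiples of some `m = n / q` with `q` bounded. The offset `m / 8` makes the
signed remainders non-negative. -/
theorem exists_add_mod_le (K R : ℕ) : ∃ P : ℕ, ∀ s : Finset ℕ, s.card ≤ K → ∀ n : ℕ, P ≤ n →
    (∀ e ∈ s, e ≤ R * n) →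
    ∃ q : ℕ, 1 ≤ q ∧ q ≤ 16 ^ K ∧
      ∀ e ∈ s, (e + n / q / 8) % (n / q) ≤ 2 * (n / q / 8) := by
  refine ⟨16 ^ K * (16 * (16 ^ K * R + 4)) + 1, fun s hs n hn he => ?_⟩
  obtain ⟨q, hq1, hqK, hq⟩ :=
    exists_mul_eq_mul_add_of_card_le s hs (show 0 < n by lia) (show 0 < 16 by norm_num)
  refine ⟨q, hq1, hqK, fun e hes => ?_⟩
  obtain ⟨p, d, hpd, hd⟩ := hq e hes
  set m := n / q with hm
  set t := n % q with ht
  have hnm : n = q * m + t := (Nat.div_add_mod n q).symm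
  have htq : t < q := Nat.mod_lt _ hq1
  have hmlarge : 16 * (16 ^ K * R + 4) ≤ m := by
    rw [hm, Nat.le_div_iff_mul_le hq1]
    calc _ ≤ 16 * (16 ^ K * R + 4) * 16 ^ K := Nat.mul_le_mul_left _ hqK
      _ ≤ n := by rw [mul_comm]; lia
  have hqR : q * R ≤ 16 ^ K * R := Nat.mul_le_mul_right _ hqK
  have hn0 : (0 : ℤ) < n := by lia
  have hq0 : (0 : ℤ) < q := by lia
  push_cast at hd
  obtain ⟨hd1, hd2⟩ := abs_lt.mp (show |d| < n by have := abs_nonneg d; lia)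
  have heR : (e : ℤ) ≤ R * n := by exact_mod_cast he e hes
  have hp0 : 0 ≤ p := by
    by_contra hneg
    have h1 : p * n ≤ (-1) * n := mul_le_mul_of_nonneg_right (by lia) hn0.le
    have h2 : (0 : ℤ) ≤ q * e := by positivity
    lia
  have hp1 : p ≤ q * R + 1 := by
    by_contra hneg
    have h1 : ((q : ℤ) * R + 2) * n ≤ p * n := mul_le_mul_of_nonneg_right (by lia) hn0.le
    have h2 : (q : ℤ) * e ≤ q * (R * n) := mul_le_mul_of_nonneg_left heR hq0.le
    nlinarith
  -- `b` is the signed remainder of `e` modulo `m`; from `q * b = p * t + d` with `t < q` and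
  -- `16 * |d| < n` it is about `m / 16` at most in absolute value
  obtain ⟨b, hb⟩ : ∃ b : ℤ, (e : ℤ) = p * m + b := ⟨e - p * m, by ring⟩
  have hnm' : (n : ℤ) = q * m + t := by exact_mod_cast hnm
  have hqb : (q : ℤ) * b = p * t + d := by
    rw [hb, hnm'] at hpd
    linear_combination hpd
  have hpt : p * t ≤ p * q := mul_le_mul_of_nonneg_left (by lia) hp0
  have hpt0 : 0 ≤ p * t := by positivity
  have hd16 : 16 * |d| < q * m + t := by rw [← hnm']; exact hd
  have habs := abs_le.mp (le_refl |d|)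
  have hup : 16 * b < 16 * p + m + 1 := by
    by_contra hneg
    have h1 : (q : ℤ) * (16 * p + m + 1) ≤ q * (16 * b) :=
      mul_le_mul_of_nonneg_left (by lia) hq0.le
    nlinarith
  have hlo : -(m + 1 : ℤ) < 16 * b := by
    by_contra hneg
    have h1 : (q : ℤ) * (16 * b) ≤ q * (-(m + 1)) :=
      mul_le_mul_of_nonneg_left (by lia) hq0.le
    nlinarith
  have hqR' : (q : ℤ) * R ≤ 16 ^ K * R := by exact_mod_cast hqR
  have hml' : 16 * (16 ^ K * (R : ℤ) + 4) ≤ m := by exact_mod_cast hmlarge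
  have hm8 : (m : ℤ) ≤ 8 * ((m / 8 : ℕ) : ℤ) + 7 := by lia
  have h8m : 8 * ((m / 8 : ℕ) : ℤ) ≤ m := by lia
  generalize m / 8 = c at *
  have hb1 : b ≤ c := by lia
  have hb2 : -(c : ℤ) ≤ b := by lia
  have hmod : (((e + c) % m : ℕ) : ℤ) = b + c := by
    push_cast
    rw [hb, show p * (m : ℤ) + b + c = (b + c) + m * p by ring, Int.add_mul_emod_self_left]
    exact Int.emod_eq_of_lt (by lia) (by lia)
  lia

/-! ### Substituting a large power of `x` for `y` -/

theorem coeff_zero_eq_zero_and_eval_divX_eq_zero {m : ℕ} {P : ℤ[X][Y]}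
    (hP : ∀ k, (P.coeff k).natDegree < m) (h : P.eval (X ^ m) = 0) :
    P.coeff 0 = 0 ∧ P.divX.eval (X ^ m) = 0 := by
  have h1 : P.divX.eval (X ^ m) * X ^ m + P.coeff 0 = 0 := by
    have h2 := congrArg (eval (X ^ m)) (divX_mul_X_add P)
    rwa [h, eval_add, eval_mul, eval_X, eval_C] at h2
  have h0 : P.coeff 0 = 0 := by
    have h2 : X ^ m ∣ P.coeff 0 := by
      rw [← dvd_add_right (dvd_mul_left (X ^ m) (P.divX.eval (X ^ m))), h1]
      exact dvd_zero _
    by_contra h3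
    have := natDegree_le_of_dvd h2 h3
    rw [natDegree_X_pow] at this
    exact absurd (hP 0) (by lia)
  refine ⟨h0, ?_⟩
  rw [h0, add_zero] at h1
  exact (mul_eq_zero.mp h1).resolve_right (pow_ne_zero m X_ne_zero)

/-- The substitution `y = x ^ m` is injective on polynomials of degree less than `m` in `x`. -/
theorem eq_zero_of_eval_X_pow_eq_zero {m : ℕ} (P : ℤ[X][Y])
    (hP : ∀ k, (P.coeff k).natDegree < m) (h : P.eval (X ^ m) = 0) : P = 0 := by
  ext1 k
  rw [coeff_zero]
  induction k generalizing P with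
  | zero => exact (coeff_zero_eq_zero_and_eval_divX_eq_zero hP h).1
  | succ k ih =>
    rw [← coeff_divX]
    refine ih _ (fun k => ?_) (coeff_zero_eq_zero_and_eval_divX_eq_zero hP h).2
    rw [coeff_divX]
    exact hP _

/-- A polynomial whose exponents have remainders at most `D` modulo `m` comes from a polynomial
of degree at most `D` in `x` by the substitution `y = x ^ m`. -/
theorem exists_eval_X_pow_eq {g : ℤ[X]} {m D E : ℕ} (hg : ∀ e ∈ g.support, e % m ≤ D)
    (hE : g.natDegree ≤ E) :
    ∃ P : ℤ[X][Y], (∀ k, (P.coeff k).natDegree ≤ D) ∧ P.natDegree ≤ E ∧ P.eval (X ^ m) = g := by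
  refine ⟨∑ e ∈ g.support, monomial (e / m) (monomial (e % m) (g.coeff e)), fun k => ?_, ?_, ?_⟩
  · rw [finsetSum_coeff]
    refine natDegree_sum_le_of_forall_le _ _ fun e he => ?_
    rw [coeff_monomial]
    split_ifs
    · exact (natDegree_monomial_le _).trans (hg e he)
    · simp
  · refine natDegree_sum_le_of_forall_le _ _ fun e he => (natDegree_monomial_le _).trans ?_
    exact (Nat.div_le_self _ _).trans ((le_natDegree_of_mem_supp e he).trans hE)
  · rw [eval_finsetSum]
    conv_rhs => rw [g.as_sum_support]
    refine Finset.sum_congr rfl fun e _ => ?_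
    rw [eval_monomial, ← pow_mul, monomial_mul_X_pow, Nat.mod_add_div]

/-- The reversal `x ^ D * y ^ E * P(1 / x, 1 / y)`, for `P` of degree at most `D` in `x` and at
most `E` in `y`. -/
noncomputable def bireflect (D E : ℕ) (P : ℤ[X][Y]) : ℤ[X][Y] :=
  ∑ k ∈ Finset.range (E + 1), monomial (E - k) (reflect D (P.coeff k))

theorem natDegree_coeff_bireflect_le {D : ℕ} (E : ℕ) {P : ℤ[X][Y]}
    (hP : ∀ k, (P.coeff k).natDegree ≤ D) (k : ℕ) :
    ((bireflect D E P).coeff k).natDegree ≤ D := by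
  rw [bireflect, finsetSum_coeff]
  refine natDegree_sum_le_of_forall_le _ _ fun e _ => ?_
  rw [coeff_monomial]
  split_ifs
  · exact (natDegree_reflect_le).trans (max_le le_rfl (hP e))
  · simp

theorem eval_bireflect {D E m : ℕ} {P : ℤ[X][Y]} (hP : ∀ k, (P.coeff k).natDegree ≤ D)
    (hE : P.natDegree ≤ E) :
    (bireflect D E P).eval (X ^ m) = reflect (D + E * m) (P.eval (X ^ m)) := by
  have hsum : reflect (D + E * m) (P.eval (X ^ m)) =
      ∑ k ∈ Finset.range (E + 1), reflect (D + E * m) (P.coeff k * (X ^ m) ^ k) := by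
    rw [eval_eq_sum_range' (Nat.lt_succ_of_le hE)]
    generalize Finset.range (E + 1) = s
    induction s using Finset.cons_induction with
    | empty => simp
    | cons a s ha ih => rw [Finset.sum_cons, Finset.sum_cons, reflect_add, ih]
  rw [hsum, bireflect, eval_finsetSum]
  refine Finset.sum_congr rfl fun k hk => ?_
  have hkE : k ≤ E := by rw [Finset.mem_range] at hk; lia
  have hle : m * k ≤ E * m := by rw [mul_comm]; exact Nat.mul_le_mul_right _ hkE
  rw [eval_monomial, ← pow_mul, ← pow_mul,
    reflect_mul _ _ (hP k) ((natDegree_X_pow_le _).trans hle), reflect_monomial, revAt_le hle]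
  congr 2
  rw [Nat.mul_sub, mul_comm E m]

theorem natDegree_coeff_mul_le {D D' : ℕ} {P Q : ℤ[X][Y]} (hP : ∀ k, (P.coeff k).natDegree ≤ D)
    (hQ : ∀ k, (Q.coeff k).natDegree ≤ D') (k : ℕ) : ((P * Q).coeff k).natDegree ≤ D + D' := by
  rw [coeff_mul]
  exact natDegree_sum_le_of_forall_le _ _ fun e _ =>
    natDegree_mul_le.trans (add_le_add (hP _) (hQ _))

theorem reflect_X_pow_mul {c N : ℕ} {p : ℤ[X]} (h : c + p.natDegree ≤ N) :
    reflect N (X ^ c * p) = X ^ (N - p.natDegree - c) * p.reverse := by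
  have hN : N = (N - p.natDegree) + p.natDegree := by lia
  conv_lhs => rw [hN]
  rw [reflect_mul _ _ ((natDegree_X_pow_le c).trans (by lia)) le_rfl, reflect_monomial,
    revAt_le (by lia), reverse]

theorem dvd_of_dvd_X_pow_mul {g p : ℤ[X]} (hg : g.coeff 0 ≠ 0) {s : ℕ} (h : g ∣ X ^ s * p) :
    g ∣ p := by
  obtain ⟨k, hk⟩ := h
  have hX : ¬ (X : ℤ[X]) ∣ g := by rwa [X_dvd_iff]
  obtain ⟨l, rfl⟩ := prime_X.pow_dvd_of_dvd_mul_left s hX (hk ▸ dvd_mul_right (X ^ s) p)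
  refine ⟨l, mul_left_cancel₀ (pow_ne_zero s X_ne_zero) (hk.trans (by ring))⟩

/-- If `g` and `X ^ c * w` come from polynomials of small degree in `x` by the substitution
`y = x ^ m`, the one for `g` being prime, then the identity `w * w.reverse = g * g.reverse` lifts
to `ℤ[x, y]`, where it decides which of `w` and `w.reverse` is divisible by `g`. -/
theorem dvd_or_dvd_reverse_of_prime {g w : ℤ[X]} {m c D E : ℕ} {G W : ℤ[X][Y]}
    (hg : g.coeff 0 ≠ 0) (hdeg : w.natDegree = g.natDegree)
    (hgw : w * w.reverse = g * g.reverse) (hm : 2 * D < m)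
    (hG : ∀ k, (G.coeff k).natDegree ≤ D) (hGE : G.natDegree ≤ E) (hGg : G.eval (X ^ m) = g)
    (hW : ∀ k, (W.coeff k).natDegree ≤ D) (hWE : W.natDegree ≤ E)
    (hWw : W.eval (X ^ m) = X ^ c * w) (hE : c + w.natDegree ≤ D + E * m) (hp : Prime G) :
    g ∣ w ∨ g ∣ w.reverse := by
  have hRW := eval_bireflect (m := m) hW hWE
  have hRG := eval_bireflect (m := m) hG hGE
  rw [hWw, reflect_X_pow_mul hE] at hRW
  rw [hGg, ← one_mul g, ← pow_zero X, reflect_X_pow_mul (by lia)] at hRG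
  have hlift : W * bireflect D E W - G * bireflect D E G = 0 := by
    refine eq_zero_of_eval_X_pow_eq_zero (m := m) _ (fun k => ?_) ?_
    · rw [coeff_sub]
      refine (natDegree_sub_le _ _).trans_lt (max_lt ?_ ?_)
      · have := natDegree_coeff_mul_le hW (natDegree_coeff_bireflect_le E hW) k
        lia
      · have := natDegree_coeff_mul_le hG (natDegree_coeff_bireflect_le E hG) k
        lia
    · have hpow : (X : ℤ[X]) ^ (D + E * m - g.natDegree) =
          X ^ c * X ^ (D + E * m - w.natDegree - c) := by
        rw [← pow_add]; congr 1; lia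
      rw [eval_sub, eval_mul, eval_mul, hRW, hRG, hWw, hGg, Nat.sub_zero, hpow]
      linear_combination X ^ c * X ^ (D + E * m - w.natDegree - c) * hgw
  have hdvd : G ∣ W * bireflect D E W := ⟨_, sub_eq_zero.mp hlift⟩
  rcases hp.dvd_or_dvd hdvd with h | h
  · left
    have h1 := eval_dvd (x := X ^ m) h
    rw [hWw, hGg] at h1
    exact dvd_of_dvd_X_pow_mul hg h1
  · right
    have h1 := eval_dvd (x := X ^ m) h
    rw [hRW, hGg] at h1
    exact dvd_of_dvd_X_pow_mul hg h1

/-! ### The twisted polynomials -/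

/-- As `f₀(0) ≠ 0`, the power of `x` in `IsXPowMulIrreducible` is trivial. -/
theorem irreducible_twistUp {r t l : ℕ} {f : ℕ → ℤ[X]} (hl : 1 ≤ l) (hf0 : (f 0).eval 0 ≠ 0)
    (h : IsXPowMulIrreducible (twistUp r f t l)) : Irreducible (twistUp r f t l) := by
  obtain ⟨k, Q, hQ, hk⟩ := h
  have hc : (twistUp r f t l).coeff 0 = f 0 := by
    rw [twistUp, finsetSum_coeff, Finset.sum_eq_single 0]
    · simp
    · intro j _ hj
      rw [coeff_C_mul, coeff_X_pow, if_neg (by positivity), mul_zero]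
    · simp
  have hk0 : k = 0 := by
    by_contra hk0
    rw [hk, coeff_C_mul] at hc
    apply hf0
    rw [← hc]
    simp [hk0]
  rw [hk, hk0, pow_zero, C_1, one_mul]
  exact hQ

theorem eval_twistUp (r t l m : ℕ) (f : ℕ → ℤ[X]) :
    (twistUp r f t l).eval (X ^ m) = ∑ j ∈ Finset.range (r + 1), f j * X ^ ((l * m + t) * j) := by
  rw [twistUp, eval_finsetSum]
  refine Finset.sum_congr rfl fun j _ => ?_
  rw [eval_mul, eval_C, eval_pow, eval_X, ← pow_mul, mul_assoc, ← pow_add]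
  ring_nf

theorem natDegree_coeff_twistUp_le {r t l D : ℕ} {f : ℕ → ℤ[X]} (hD : ∀ j ≤ r, (f j).natDegree ≤ D)
    (k : ℕ) : ((twistUp r f t l).coeff k).natDegree ≤ D + r * t := by
  rw [twistUp, finsetSum_coeff]
  refine natDegree_sum_le_of_forall_le _ _ fun j hj => ?_
  have hjr : j ≤ r := by rw [Finset.mem_range] at hj; lia
  rw [coeff_C_mul, coeff_X_pow]
  split_ifs
  · rw [mul_one]
    exact natDegree_mul_le.trans (add_le_add (hD j hjr)
      ((natDegree_X_pow_le _).trans (Nat.mul_le_mul_right _ hjr)))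
  · simp

theorem natDegree_twistUp_le (r t l : ℕ) (f : ℕ → ℤ[X]) : (twistUp r f t l).natDegree ≤ r * l := by
  rw [twistUp]
  refine natDegree_sum_le_of_forall_le _ _ fun j hj => ?_
  have hjr : j ≤ r := by rw [Finset.mem_range] at hj; lia
  exact (natDegree_C_mul_X_pow_le _ _).trans (Nat.mul_le_mul_right _ hjr)

end SparsePoly

theorem theorem4 (r : ℕ) (hr : 1 ≤ r) (f : ℕ → ℤ[X])
    (hgcd : ∀ d : ℤ[X], (∀ j ≤ r, d ∣ f j) → IsUnit d)
    (hf0 : (f 0).eval 0 ≠ 0) (hfr : f r ≠ 0) :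
    ∃ n₀ : ℕ, ∀ n : ℕ, n₀ ≤ n →
      (∀ t l : ℕ, 1 ≤ l →
        SparsePoly.IsXPowMulIrreducible (SparsePoly.twistUp r f t l) ∧
          SparsePoly.IsXPowMulIrreducible (SparsePoly.twistDown r f t l)) →
      ¬ SparsePoly.Reducible
          (SparsePoly.nonreciprocalPart ((SparsePoly.bivariate r f).eval (X ^ n))) := by
  open SparsePoly in
  -- `S ^ 2` bounds the number of terms of `w` below, `D` the degrees of the `f j`
  let S : ℕ := (∑ j ∈ Finset.range (r + 1), ∑ i ∈ (f j).support, |(f j).coeff i|).toNat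
  let D : ℕ := ∑ j ∈ Finset.range (r + 1), (f j).natDegree
  have hD : ∀ j ≤ r, (f j).natDegree ≤ D := fun j hj =>
    Finset.single_le_sum (f := fun j => (f j).natDegree) (fun _ _ => Nat.zero_le _)
      (Finset.mem_range.mpr (Nat.lt_succ_of_le hj))
  have hS : (S : ℤ) = ∑ j ∈ Finset.range (r + 1), ∑ i ∈ (f j).support, |(f j).coeff i| :=
    Int.toNat_of_nonneg (Finset.sum_nonneg fun _ _ => Finset.sum_nonneg fun _ _ => abs_nonneg _)
  obtain ⟨P, hP⟩ := exists_add_mod_le (S ^ 2) (r + 1)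
  -- as `q ≤ 16 ^ S ^ 2`, the last summand forces `m = n / q` to exceed the degree of
  -- `twistUp r f t q` in `x`, for `t < q`, by a factor of 8
  refine ⟨P + D + 1 + 16 ^ S ^ 2 * (8 * (D + r * 16 ^ S ^ 2 + 1)), fun n hn htwist hred => ?_⟩
  have hG : (bivariate r f).eval (X ^ n) = ∑ j ∈ Finset.range (r + 1), f j * X ^ (n * j) := by
    rw [bivariate, eval_finsetSum]
    refine Finset.sum_congr rfl fun j _ => ?_
    rw [eval_mul, eval_C, eval_pow, eval_X, ← pow_mul]
  rw [hG] at hred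
  set g : ℤ[X] := ∑ j ∈ Finset.range (r + 1), f j * X ^ (n * j) with hg
  have hg0 : g.coeff 0 ≠ 0 := by
    have : g.coeff 0 = (f 0).eval 0 := by
      rw [hg, finsetSum_coeff, Finset.sum_eq_single 0]
      · simp [coeff_zero_eq_eval_zero]
      · intro j _ hj
        have : n * j ≠ 0 := mul_ne_zero (by lia) hj
        rw [mul_coeff_zero, coeff_X_pow, if_neg this.symm, mul_zero]
      · simp
    rwa [this]
  have hgdeg : g.natDegree ≤ (r + 1) * n := by
    refine natDegree_sum_le_of_forall_le _ _ fun j hj => ?_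
    have hjr : j ≤ r := by rw [Finset.mem_range] at hj; lia
    have h1 := natDegree_mul_le (p := f j) (q := X ^ (n * j))
    rw [natDegree_X_pow] at h1
    have h2 := Nat.mul_le_mul_left n hjr
    have h3 := hD j hjr
    rw [add_mul, mul_comm r n]
    lia
  obtain ⟨a, b, hab, ha, hb⟩ := exists_mul_not_isReciprocal hg0 hred
  have ha0 : a.coeff 0 ≠ 0 := coeff_zero_ne_of_dvd ⟨b, hab⟩ hg0
  have hb0 : b.coeff 0 ≠ 0 := coeff_zero_ne_of_dvd ⟨a, hab.trans (mul_comm _ _)⟩ hg0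
  have ha' : a ≠ 0 := by rintro rfl; simp at ha0
  have hb' : b ≠ 0 := by rintro rfl; simp at hb0
  -- the competitor of `g`: it has the same product with its reversal
  set w := a * b.reverse with hw
  have hwr : w.reverse = a.reverse * b := by
    rw [hw, reverse_mul_of_domain, reverse_reverse_of_coeff_zero_ne hb0]
  have hwg : w * w.reverse = g * g.reverse := by
    rw [hwr, hab, reverse_mul_of_domain, hw]; ring
  have hbdeg : b.reverse.natDegree = b.natDegree := by
    rw [reverse_natDegree, natTrailingDegree_eq_zero.mpr (Or.inr hb0), Nat.sub_zero]
  have hwdeg : w.natDegree = g.natDegree := by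
    rw [hw, hab, natDegree_mul ha' (by simpa using hb'), natDegree_mul ha' hb', hbdeg]
  have hw0 : w.coeff 0 ≠ 0 := by
    rw [hw, mul_coeff_zero, coeff_zero_reverse]
    exact mul_ne_zero ha0 (leadingCoeff_ne_zero.mpr hb')
  have hcard : w.support.card ≤ S ^ 2 := by
    have h1 := (card_support_le_of_mul_reverse_eq hw0 hg0 hwdeg hwg).trans
      (sum_sq_coeff_le r f fun j => n * j)
    rw [← hS] at h1
    exact_mod_cast h1
  obtain ⟨q, hq1, hqK, hq⟩ := hP w.support hcard n (by lia) fun e he =>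
    (le_natDegree_of_mem_supp e he).trans (hwdeg ▸ hgdeg)
  set m := n / q with hm
  set c := m / 8 with hc
  have htq : n % q < q := Nat.mod_lt _ hq1
  have hml : 8 * (D + r * 16 ^ S ^ 2 + 1) ≤ m := by
    rw [hm, Nat.le_div_iff_mul_le hq1]
    calc _ ≤ 8 * (D + r * 16 ^ S ^ 2 + 1) * 16 ^ S ^ 2 := Nat.mul_le_mul_left _ hqK
      _ ≤ n := by rw [mul_comm]; lia
  have hrt : r * (n % q) ≤ r * 16 ^ S ^ 2 := Nat.mul_le_mul_left _ (by lia)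
  have hDc : D + r * (n % q) ≤ 2 * c := by lia
  have hXw : (X ^ c * w).natDegree ≤ r * q + (c + w.natDegree) := by
    have := natDegree_mul_le (p := X ^ c) (q := w)
    rw [natDegree_X_pow] at this
    lia
  have hmod : ∀ e ∈ (X ^ c * w).support, e % m ≤ 2 * c := by
    intro e he
    rw [mem_support_iff, coeff_X_pow_mul'] at he
    split_ifs at he with hce
    · have := hq (e - c) (mem_support_iff.mpr he)
      rwa [Nat.sub_add_cancel hce] at this
    · exact absurd rfl he
  obtain ⟨W, hW, hWE, hWw⟩ := exists_eval_X_pow_eq hmod hXw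
  have hprime : Prime (twistUp r f (n % q) q) :=
    (irreducible_twistUp hq1 hf0 (htwist (n % q) q hq1).1).prime
  have heval : (twistUp r f (n % q) q).eval (X ^ m) = g := by
    rw [eval_twistUp, hm, Nat.div_add_mod]
  have hE : c + w.natDegree ≤ 2 * c + (r * q + (c + w.natDegree)) * m := by
    have := Nat.le_mul_of_pos_right (r * q + (c + w.natDegree)) (show 0 < m by lia)
    lia
  rcases dvd_or_dvd_reverse_of_prime hg0 hwdeg hwg (show 2 * (2 * c) < m by lia)
    (fun k => (natDegree_coeff_twistUp_le hD k).trans hDc)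
    ((natDegree_twistUp_le r _ q f).trans (Nat.le_add_right _ _)) heval hW hWE hWw hE hprime
    with h | h
  · rw [hab, hw] at h
    exact hb (isReciprocal_of_dvd_reverse hb0 ((mul_dvd_mul_iff_left ha').mp h))
  · rw [hab, hwr] at h
    exact ha (isReciprocal_of_dvd_reverse ha0 ((mul_dvd_mul_iff_right hb').mp h))
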